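/- **Theorem.** Let $(M^{2n+1},\varphi,\xi,\eta,g)$ be an anti-quasi-Sasakian (aqS) manifold, i.e. a smooth manifold with a smooth $(1,1)$-tensor field $\varphi$, vector field $\xi$, $1$-form $\eta$ and Riemannian metric $g$ such that $$\varphi^2=-I+\eta\otimes\xi,\qquad \eta(\xi)=1,\qquad g(\varphi X,\varphi Y)=g(X,Y)-\eta(X)\eta(Y),$$ $$d\Phi=0,\qquad N_\varphi=2\,d\eta\otimes\xi,$$ where $\Phi(X,Y)=g(X,\varphi Y)$, $d\eta(X,Y)=X(\eta(Y))-Y(\eta(X))-\eta([X,Y])$ and $$N_\varphi(X,Y)=[\varphi X,\varphi Y]+\varphi^2[X,Y]-\varphi[X,\varphi Y]-\varphi[\varphi X,Y]+d\eta(X,Y)\xi .$$ Let $\nabla$ be the Levi-Civita connection of $g$, let $R(X,Y)Z=\nabla_X\nabla_YZ-\nabla_Y\nabla_XZ-\nabla_{[X,Y]}Z$, and let $K(u,v)=g(R(u,v)v,u)$ be the sectional curvature of the plane spanned by orthonormal tangent vectors $u,v$. Put $A:=-\varphi\circ\nabla\xi$ and $\psi:=A\varphi$. Then the following are equivalent: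 (a) $K(\xi_x,u)=1$ for every $x\in M$ and every unit vector $u\in T_xM$ with $\eta(u)=0$; (b) $\psi^2=A^2=-I+\eta\otimes\xi$; (c) $(A,\varphi,\psi,\xi,\eta,g)$ is a double aqS-Sasakian structure; that is, writing $(\varphi_1,\varphi_2,\varphi_3)=(A,\varphi,\psi)$, each $(\varphi_i,\xi,\eta,g)$ is an almost contact metric structure (it satisfies the first three displayed identities with $\varphi_i$ in place of $\varphi$), $\varphi_i\varphi_j=\varphi_k=-\varphi_j\varphi_i$ for every even permutation $(i,j,k)$ of $(1,2,3)$, and, with $\Phi_i(X,Y)=g(X,\varphi_iY)$, one has $d\Phi_1=0$, $d\Phi_2=0$, $d\eta=2\Phi_3$. -/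

import Mathlib

open Bundle VectorField
open scoped Manifold ContDiff

set_option linter.unusedSectionVars false

noncomputable section

namespace AlmostContact

/-! ### The Levi-Civita connection -/

variable {E : Type*} [NormedAddCommGroup E] [NormedSpace ℝ E] [FiniteDimensional ℝ E]
  {H : Type*} [TopologicalSpace H] {I : ModelWithCorners ℝ E H}
  {M : Type*} [TopologicalSpace M] [ChartedSpace H M] [IsManifold I ∞ M]
  (g : ContMDiffRiemannianMetric I ∞ E (fun x : M ↦ TangentSpace I x))

/-- The right-hand side of the Koszul formula. -/
def koszul (X Y Z : Π x : M, TangentSpace I x) (x : M) : ℝ :=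
  mvfderiv I (fun y ↦ g.inner y (Y y) (Z y)) x (X x)
    + mvfderiv I (fun y ↦ g.inner y (Z y) (X y)) x (Y x)
    - mvfderiv I (fun y ↦ g.inner y (X y) (Y y)) x (Z x)
    + g.inner x (mlieBracket I X Y x) (Z x)
    - g.inner x (mlieBracket I X Z x) (Y x)
    - g.inner x (mlieBracket I Y Z x) (X x)

variable {g}

theorem mdifferentiableAt_metric {Y Z : Π x : M, TangentSpace I x} {x : M}
    (hY : MDiffAt (T% Y) x) (hZ : MDiffAt (T% Z) x) :
    MDiffAt (fun y ↦ g.inner y (Y y) (Z y)) x := by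
  have h : MDifferentiableAt I (I.prod 𝓘(ℝ))
      (fun m ↦ TotalSpace.mk' ℝ (E := Bundle.Trivial M ℝ) m (g.inner m (Y m) (Z m))) x := by
    apply MDifferentiableAt.clm_bundle_apply₂ (F₁ := E) (F₂ := E)
    · exact g.contMDiff.mdifferentiableAt (by simp)
    · exact hY
    · exact hZ
  simp only [mdifferentiableAt_totalSpace] at h
  exact h.2

theorem koszul_tensorial_left {Y Z : Π x : M, TangentSpace I x} {x : M}
    (hY : MDiffAt (T% Y) x) (hZ : MDiffAt (T% Z) x) :
    TensorialAt I E (fun X ↦ koszul g X Y Z x) x where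
  smul {f X} hf hX := by
    have e1 : (fun y ↦ g.inner y (Z y) ((f • X) y)) = f * (fun y ↦ g.inner y (Z y) (X y)) := by
      ext y; simp
    have e2 : (fun y ↦ g.inner y ((f • X) y) (Y y)) = f * (fun y ↦ g.inner y (X y) (Y y)) := by
      ext y; simp
    simp only [koszul, e1, e2, mvfderiv_mul hf (mdifferentiableAt_metric hZ hX),
      mvfderiv_mul hf (mdifferentiableAt_metric hX hY), mlieBracket_smul_left hf hX]
    simp [g.symm x (Z x) (X x)]
    ring
  add {X X'} hX hX' := by
    have e1 : (fun y ↦ g.inner y (Z y) ((X + X') y))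
        = (fun y ↦ g.inner y (Z y) (X y)) + (fun y ↦ g.inner y (Z y) (X' y)) := by
      ext y; simp
    have e2 : (fun y ↦ g.inner y ((X + X') y) (Y y))
        = (fun y ↦ g.inner y (X y) (Y y)) + (fun y ↦ g.inner y (X' y) (Y y)) := by
      ext y; simp
    simp only [koszul, e1, e2,
      mvfderiv_add (mdifferentiableAt_metric hZ hX) (mdifferentiableAt_metric hZ hX'),
      mvfderiv_add (mdifferentiableAt_metric hX hY) (mdifferentiableAt_metric hX' hY),
      mlieBracket_add_left hX hX']
    simp
    ring

theorem koszul_tensorial_right {X Y : Π x : M, TangentSpace I x} {x : M}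
    (hX : MDiffAt (T% X) x) (hY : MDiffAt (T% Y) x) :
    TensorialAt I E (fun Z ↦ koszul g X Y Z x) x where
  smul {f Z} hf hZ := by
    have e1 : (fun y ↦ g.inner y ((f • Z) y) (X y)) = f * (fun y ↦ g.inner y (Z y) (X y)) := by
      ext y; simp
    have e2 : (fun y ↦ g.inner y (Y y) ((f • Z) y)) = f * (fun y ↦ g.inner y (Y y) (Z y)) := by
      ext y; simp
    simp only [koszul, e1, e2, mvfderiv_mul hf (mdifferentiableAt_metric hZ hX),
      mvfderiv_mul hf (mdifferentiableAt_metric hY hZ), mlieBracket_smul_right hf hZ]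
    simp [g.symm x (Z x) (Y x)]
    ring
  add {Z Z'} hZ hZ' := by
    have e1 : (fun y ↦ g.inner y ((Z + Z') y) (X y))
        = (fun y ↦ g.inner y (Z y) (X y)) + (fun y ↦ g.inner y (Z' y) (X y)) := by
      ext y; simp
    have e2 : (fun y ↦ g.inner y (Y y) ((Z + Z') y))
        = (fun y ↦ g.inner y (Y y) (Z y)) + (fun y ↦ g.inner y (Y y) (Z' y)) := by
      ext y; simp
    simp only [koszul, e1, e2,
      mvfderiv_add (mdifferentiableAt_metric hZ hX) (mdifferentiableAt_metric hZ' hX),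
      mvfderiv_add (mdifferentiableAt_metric hY hZ) (mdifferentiableAt_metric hY hZ'),
      mlieBracket_add_right hZ hZ']
    simp
    ring

theorem koszul_add_middle {X Y Y' Z : Π x : M, TangentSpace I x} {x : M}
    (hX : MDiffAt (T% X) x) (hY : MDiffAt (T% Y) x) (hY' : MDiffAt (T% Y') x)
    (hZ : MDiffAt (T% Z) x) :
    koszul g X (Y + Y') Z x = koszul g X Y Z x + koszul g X Y' Z x := by
  have e1 : (fun y ↦ g.inner y ((Y + Y') y) (Z y))
      = (fun y ↦ g.inner y (Y y) (Z y)) + (fun y ↦ g.inner y (Y' y) (Z y)) := by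
    ext y; simp
  have e2 : (fun y ↦ g.inner y (X y) ((Y + Y') y))
      = (fun y ↦ g.inner y (X y) (Y y)) + (fun y ↦ g.inner y (X y) (Y' y)) := by
    ext y; simp
  simp only [koszul, e1, e2,
    mvfderiv_add (mdifferentiableAt_metric hY hZ) (mdifferentiableAt_metric hY' hZ),
    mvfderiv_add (mdifferentiableAt_metric hX hY) (mdifferentiableAt_metric hX hY'),
    mlieBracket_add_right hY hY', mlieBracket_add_left hY hY']
  simp
  ring

theorem koszul_smul_middle {X Y Z : Π x : M, TangentSpace I x} {f : M → ℝ} {x : M}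
    (hX : MDiffAt (T% X) x) (hY : MDiffAt (T% Y) x) (hf : MDiffAt f x)
    (hZ : MDiffAt (T% Z) x) :
    koszul g X (f • Y) Z x
      = f x * koszul g X Y Z x + 2 * (mvfderiv I f x (X x) * g.inner x (Y x) (Z x)) := by
  have e1 : (fun y ↦ g.inner y ((f • Y) y) (Z y)) = f * (fun y ↦ g.inner y (Y y) (Z y)) := by
    ext y; simp
  have e2 : (fun y ↦ g.inner y (X y) ((f • Y) y)) = f * (fun y ↦ g.inner y (X y) (Y y)) := by
    ext y; simp
  simp only [koszul, e1, e2, mvfderiv_mul hf (mdifferentiableAt_metric hY hZ),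
    mvfderiv_mul hf (mdifferentiableAt_metric hX hY), mlieBracket_smul_right hf hY,
    mlieBracket_smul_left hf hY]
  simp [g.symm x (Y x) (X x)]
  ring

variable (g) in
/-- For `Y` differentiable at `x`, the bilinear form `(v, w) ↦ ½ koszul(v, Y, w)` on `T_x M`. -/
def koszulForm (Y : Π x : M, TangentSpace I x) (x : M) (hY : MDiffAt (T% Y) x) :
    TangentSpace I x →L[ℝ] TangentSpace I x →L[ℝ] ℝ :=
  (2⁻¹ : ℝ) • TensorialAt.mkHom₂ (fun X Z ↦ koszul g X Y Z x) x
    (fun _ hZ ↦ koszul_tensorial_left hY hZ) (fun _ hX ↦ koszul_tensorial_right hX hY)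

theorem koszulForm_apply {X Y Z : Π x : M, TangentSpace I x} {x : M}
    (hX : MDiffAt (T% X) x) (hY : MDiffAt (T% Y) x) (hZ : MDiffAt (T% Z) x) :
    koszulForm g Y x hY (X x) (Z x) = 2⁻¹ * koszul g X Y Z x := by
  have := TensorialAt.mkHom₂_apply (Φ := fun X Z ↦ koszul g X Y Z x) (x := x)
    (fun _ hZ ↦ koszul_tensorial_left hY hZ) (fun _ hX ↦ koszul_tensorial_right hX hY) hX hZ
  simp [koszulForm, this]

theorem metric_injective (x : M) : Function.Injective (g.inner x) := by
  rw [injective_iff_map_eq_zero]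
  intro v hv
  by_contra h
  have := g.pos x v h
  simp [hv] at this

variable (g) in
/-- The isomorphism `T_x M ≃ T_x^* M`, `v ↦ g(v, ·)`. -/
def metricFlat (x : M) : TangentSpace I x ≃L[ℝ] (TangentSpace I x →L[ℝ] ℝ) :=
  have : FiniteDimensional ℝ (TangentSpace I x) := inferInstanceAs (FiniteDimensional ℝ E)
  have : T2Space (TangentSpace I x) := inferInstanceAs (T2Space E)
  have hd : Module.finrank ℝ (TangentSpace I x)
      = Module.finrank ℝ (TangentSpace I x →L[ℝ] ℝ) := by
    rw [← (LinearMap.toContinuousLinearMap (𝕜 := ℝ) (E := TangentSpace I x)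
      (F' := ℝ)).finrank_eq]
    exact Subspace.dual_finrank_eq.symm
  (LinearMap.linearEquivOfInjective (g.inner x).toLinearMap
    (metric_injective x) hd).toContinuousLinearEquiv

@[simp]
theorem metricFlat_apply (x : M) (v w : TangentSpace I x) :
    metricFlat g x v w = g.inner x v w := rfl

variable (g) in
open scoped Classical in
/-- `∇_v Y` is the vector with `g(∇_v Y, w) = ½ koszul(v, Y, w)` for all `w`; the value is `0` by
convention where `Y` is not differentiable. -/
def leviCivitaFun (Y : Π x : M, TangentSpace I x) (x : M) :
    TangentSpace I x →L[ℝ] TangentSpace I x :=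
  if hY : MDiffAt (T% Y) x then
    ((metricFlat g x).symm : (TangentSpace I x →L[ℝ] ℝ) →L[ℝ] TangentSpace I x) ∘L
      koszulForm g Y x hY
  else 0

theorem metric_leviCivitaFun {X Y Z : Π x : M, TangentSpace I x} {x : M}
    (hX : MDiffAt (T% X) x) (hY : MDiffAt (T% Y) x) (hZ : MDiffAt (T% Z) x) :
    g.inner x (leviCivitaFun g Y x (X x)) (Z x) = 2⁻¹ * koszul g X Y Z x := by
  rw [← koszulForm_apply hX hY hZ, leviCivitaFun, dif_pos hY, ← metricFlat_apply]
  simp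

/-- Two tangent vectors are equal if they have the same products with all local vector fields. -/
theorem metric_ext {x : M} {u v : TangentSpace I x}
    (h : ∀ Z : Π x : M, TangentSpace I x, MDiffAt (T% Z) x →
      g.inner x u (Z x) = g.inner x v (Z x)) : u = v := by
  apply metric_injective (g := g) x
  ext w
  have := h (FiberBundle.extend E w) (FiberBundle.mdifferentiableAt_extend ..)
  simpa using this

variable (g) in
/-- The Levi-Civita connection of the Riemannian metric `g`. -/
def leviCivita : CovariantDerivative I E (TangentSpace I : M → Type _) where
  toFun := leviCivitaFun g
  isCovariantDerivativeOnUniv :=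
    { add := by
        intro Y Y' x hY hY' _
        ext v
        apply metric_ext (g := g)
        intro Z hZ
        have hX := FiberBundle.mdifferentiableAt_extend I E v
        have hs := mdifferentiableAt_add_section hY hY'
        have e := metric_leviCivitaFun (g := g) hX hs hZ
        have e1 := metric_leviCivitaFun (g := g) hX hY hZ
        have e2 := metric_leviCivitaFun (g := g) hX hY' hZ
        simp only [FiberBundle.extend_apply_self] at e e1 e2
        rw [e, koszul_add_middle hX hY hY' hZ]
        simp [e1, e2]
        ring
      leibniz := by
        intro Y f x hY hf _
        ext v
        apply metric_ext (g := g)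
        intro Z hZ
        have hX := FiberBundle.mdifferentiableAt_extend I E v
        have hs := hf.smul_section hY
        have e := metric_leviCivitaFun (g := g) hX hs hZ
        have e1 := metric_leviCivitaFun (g := g) hX hY hZ
        simp only [FiberBundle.extend_apply_self] at e e1
        rw [e, koszul_smul_middle hX hY hf hZ]
        simp [e1]
        ring }

theorem metric_leviCivita {X Y Z : Π x : M, TangentSpace I x} {x : M}
    (hX : MDiffAt (T% X) x) (hY : MDiffAt (T% Y) x) (hZ : MDiffAt (T% Z) x) :
    g.inner x (leviCivita g Y x (X x)) (Z x) = 2⁻¹ * koszul g X Y Z x :=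
  metric_leviCivitaFun hX hY hZ

/-- The Levi-Civita connection is compatible with the metric. -/
theorem leviCivita_metric {X Y Z : Π x : M, TangentSpace I x} {x : M}
    (hX : MDiffAt (T% X) x) (hY : MDiffAt (T% Y) x) (hZ : MDiffAt (T% Z) x) :
    mvfderiv I (fun y ↦ g.inner y (Y y) (Z y)) x (X x)
      = g.inner x (leviCivita g Y x (X x)) (Z x) + g.inner x (Y x) (leviCivita g Z x (X x)) := by
  rw [g.symm x (Y x), metric_leviCivita hX hY hZ, metric_leviCivita hX hZ hY]
  have e1 : (fun y ↦ g.inner y (Z y) (Y y)) = fun y ↦ g.inner y (Y y) (Z y) := by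
    ext y; exact g.symm ..
  have e2 : (fun y ↦ g.inner y (Y y) (X y)) = fun y ↦ g.inner y (X y) (Y y) := by
    ext y; exact g.symm ..
  have e3 : (fun y ↦ g.inner y (X y) (Z y)) = fun y ↦ g.inner y (Z y) (X y) := by
    ext y; exact g.symm ..
  simp only [koszul, e1, e2, e3]
  rw [mlieBracket_swap_apply (V := Z) (W := Y)]
  simp
  ring

/-- The Levi-Civita connection is torsion free. -/
theorem leviCivita_torsion : (leviCivita g).torsion = 0 := by
  rw [CovariantDerivative.torsion_eq_zero_iff]
  intro X Y x hX hY
  apply metric_ext (g := g)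
  intro Z hZ
  rw [map_sub, sub_apply, metric_leviCivita hX hY hZ,
    metric_leviCivita hY hX hZ]
  have e1 : (fun y ↦ g.inner y (Z y) (Y y)) = fun y ↦ g.inner y (Y y) (Z y) := by
    ext y; exact g.symm ..
  have e2 : (fun y ↦ g.inner y (Y y) (X y)) = fun y ↦ g.inner y (X y) (Y y) := by
    ext y; exact g.symm ..
  have e3 : (fun y ↦ g.inner y (X y) (Z y)) = fun y ↦ g.inner y (Z y) (X y) := by
    ext y; exact g.symm ..
  simp only [koszul, e1, e2, e3]
  rw [mlieBracket_swap_apply (V := Y) (W := X)]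
  simp
  ring


/-! ### Curvature -/

variable (g) in
/-- `R(X, Y)Z = ∇_X ∇_Y Z - ∇_Y ∇_X Z - ∇_{[X, Y]} Z`, where `∇` is the Levi-Civita connection of
`g`; here `leviCivita g Z x v` is `∇_v Z` at `x`. -/
def curvatureField (X Y Z : Π x : M, TangentSpace I x) (x : M) : TangentSpace I x :=
  leviCivita g (fun y ↦ leviCivita g Z y (Y y)) x (X x)
    - leviCivita g (fun y ↦ leviCivita g Z y (X y)) x (Y x)
    - leviCivita g Z x (mlieBracket I X Y x)

variable (g) in
/-- The Riemann curvature tensor `R_x(u, v)w` on tangent vectors at `x`, computed with the standard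
extensions of `u`, `v`, `w` to vector fields that are smooth near `x`. -/
def curvature (x : M) (u v w : TangentSpace I x) : TangentSpace I x :=
  curvatureField g (FiberBundle.extend E u) (FiberBundle.extend E v) (FiberBundle.extend E w) x

variable (g) in
/-- The sectional curvature `K(u, v) = g(R(u, v)v, u)` of the plane spanned by two orthonormal
tangent vectors `u`, `v` at `x`. -/
def sectionalCurvature (x : M) (u v : TangentSpace I x) : ℝ :=
  g.inner x (curvature g x u v v) u

/-! ### Exterior derivatives and the tensor `N_φ`

The expressions below are tensorial in the vector fields `X`, `Y`, `Z`. Identities between them are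
tested at each point on the vector fields that are smooth at that point, which by tensoriality is
the same as testing them on global vector fields. -/

/-- The vector field `X` is smooth at `x`. -/
def SmoothAt (X : Π x : M, TangentSpace I x) (x : M) : Prop := CMDiffAt ∞ (T% X) x

/-- `dη(X, Y) = X(η(Y)) - Y(η(X)) - η([X, Y])`. -/
def extDerivOne (η : Π x : M, TangentSpace I x →L[ℝ] ℝ) (X Y : Π x : M, TangentSpace I x)
    (x : M) : ℝ :=
  mvfderiv I (fun y ↦ η y (Y y)) x (X x) - mvfderiv I (fun y ↦ η y (X y)) x (Y x)
    - η x (mlieBracket I X Y x)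

/-- `dβ(X, Y, Z) = X(β(Y, Z)) + Y(β(Z, X)) + Z(β(X, Y)) - β([X, Y], Z) - β([Y, Z], X)
- β([Z, X], Y)` for a 2-form `β`. -/
def extDerivTwo (β : Π x : M, TangentSpace I x → TangentSpace I x → ℝ)
    (X Y Z : Π x : M, TangentSpace I x) (x : M) : ℝ :=
  mvfderiv I (fun y ↦ β y (Y y) (Z y)) x (X x)
    + mvfderiv I (fun y ↦ β y (Z y) (X y)) x (Y x)
    + mvfderiv I (fun y ↦ β y (X y) (Y y)) x (Z x)
    - β x (mlieBracket I X Y x) (Z x)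
    - β x (mlieBracket I Y Z x) (X x)
    - β x (mlieBracket I Z X x) (Y x)

/-- `dβ = 0`. -/
def IsClosedTwoForm (β : Π x : M, TangentSpace I x → TangentSpace I x → ℝ) : Prop :=
  ∀ (x : M) (X Y Z : Π x : M, TangentSpace I x), SmoothAt X x → SmoothAt Y x → SmoothAt Z x →
    extDerivTwo β X Y Z x = 0

/-- `N_φ(X, Y) = [φX, φY] + φ²[X, Y] - φ[X, φY] - φ[φX, Y] + dη(X, Y)ξ`. -/
def normalityTensor (φ : Π x : M, TangentSpace I x →L[ℝ] TangentSpace I x)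
    (ξ : Π x : M, TangentSpace I x) (η : Π x : M, TangentSpace I x →L[ℝ] ℝ)
    (X Y : Π x : M, TangentSpace I x) (x : M) : TangentSpace I x :=
  mlieBracket I (fun y ↦ φ y (X y)) (fun y ↦ φ y (Y y)) x
    + φ x (φ x (mlieBracket I X Y x))
    - φ x (mlieBracket I X (fun y ↦ φ y (Y y)) x)
    - φ x (mlieBracket I (fun y ↦ φ y (X y)) Y x)
    + extDerivOne η X Y x • ξ x

/-! ### Almost contact metric structures -/

variable (g) in
/-- `(φ, ξ, η, g)` is a (smooth) almost contact metric structure. -/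
structure IsAlmostContactMetric (φ : Π x : M, TangentSpace I x →L[ℝ] TangentSpace I x)
    (ξ : Π x : M, TangentSpace I x) (η : Π x : M, TangentSpace I x →L[ℝ] ℝ) : Prop where
  smooth_phi : ContMDiff I (I.prod 𝓘(ℝ, E →L[ℝ] E)) ∞
    (fun x ↦ TotalSpace.mk' (E →L[ℝ] E)
      (E := fun x : M ↦ TangentSpace I x →L[ℝ] TangentSpace I x) x (φ x))
  smooth_xi : ContMDiff I (I.prod 𝓘(ℝ, E)) ∞
    (fun x ↦ TotalSpace.mk' E (E := fun x : M ↦ TangentSpace I x) x (ξ x))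
  smooth_eta : ContMDiff I (I.prod 𝓘(ℝ, E →L[ℝ] ℝ)) ∞
    (fun x ↦ TotalSpace.mk' (E →L[ℝ] ℝ)
      (E := fun x : M ↦ TangentSpace I x →L[ℝ] Bundle.Trivial M ℝ x) x (η x))
  phi_sq : ∀ (x : M) (v : TangentSpace I x), φ x (φ x v) = -v + η x v • ξ x
  eta_xi : ∀ x : M, η x (ξ x) = 1
  compatible : ∀ (x : M) (v w : TangentSpace I x),
    g.inner x (φ x v) (φ x w) = g.inner x v w - η x v * η x w

variable (g) in
/-- The fundamental 2-form `Φ(X, Y) = g(X, φY)`. -/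
def fundamentalForm (φ : Π x : M, TangentSpace I x →L[ℝ] TangentSpace I x) (x : M)
    (v w : TangentSpace I x) : ℝ :=
  g.inner x v (φ x w)

variable (g) in
/-- `(φ, ξ, η, g)` is anti-quasi-Sasakian: an almost contact metric structure with `dΦ = 0` and
`N_φ = 2 dη ⊗ ξ`. -/
structure IsAntiQuasiSasakian (φ : Π x : M, TangentSpace I x →L[ℝ] TangentSpace I x)
    (ξ : Π x : M, TangentSpace I x) (η : Π x : M, TangentSpace I x →L[ℝ] ℝ) : Prop
    extends IsAlmostContactMetric g φ ξ η where
  closed : IsClosedTwoForm (fundamentalForm g φ)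
  antiNormal : ∀ (x : M) (X Y : Π x : M, TangentSpace I x), SmoothAt X x → SmoothAt Y x →
    normalityTensor φ ξ η X Y x = (2 * extDerivOne η X Y x) • ξ x

variable (g) in
/-- The operator `A = -φ ∘ ∇ξ`. -/
def operatorA (φ : Π x : M, TangentSpace I x →L[ℝ] TangentSpace I x)
    (ξ : Π x : M, TangentSpace I x) (x : M) : TangentSpace I x →L[ℝ] TangentSpace I x :=
  -(φ x ∘L leviCivita g ξ x)

variable (g) in
/-- The operator `ψ = A ∘ φ`. -/
def operatorPsi (φ : Π x : M, TangentSpace I x →L[ℝ] TangentSpace I x)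
    (ξ : Π x : M, TangentSpace I x) (x : M) : TangentSpace I x →L[ℝ] TangentSpace I x :=
  operatorA g φ ξ x ∘L φ x

variable (g) in
/-- `(φ₁, φ₂, φ₃, ξ, η, g)` is an `Sp(n)`-almost contact metric structure: three almost contact
metric structures with the same `ξ`, `η`, `g` satisfying the quaternionic identities. -/
structure IsSpAlmostContactMetric (φ₁ φ₂ φ₃ : Π x : M, TangentSpace I x →L[ℝ] TangentSpace I x)
    (ξ : Π x : M, TangentSpace I x) (η : Π x : M, TangentSpace I x →L[ℝ] ℝ) : Prop where
  acm₁ : IsAlmostContactMetric g φ₁ ξ η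
  acm₂ : IsAlmostContactMetric g φ₂ ξ η
  acm₃ : IsAlmostContactMetric g φ₃ ξ η
  quat₁₂ : ∀ (x : M) (v : TangentSpace I x), φ₁ x (φ₂ x v) = φ₃ x v
  quat₂₁ : ∀ (x : M) (v : TangentSpace I x), φ₂ x (φ₁ x v) = -φ₃ x v
  quat₂₃ : ∀ (x : M) (v : TangentSpace I x), φ₂ x (φ₃ x v) = φ₁ x v
  quat₃₂ : ∀ (x : M) (v : TangentSpace I x), φ₃ x (φ₂ x v) = -φ₁ x v
  quat₃₁ : ∀ (x : M) (v : TangentSpace I x), φ₃ x (φ₁ x v) = φ₂ x v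
  quat₁₃ : ∀ (x : M) (v : TangentSpace I x), φ₁ x (φ₃ x v) = -φ₂ x v

variable (g) in
/-- `(φ₁, φ₂, φ₃, ξ, η, g)` is a double aqS-Sasakian structure: an `Sp(n)`-almost contact metric
structure with `dΦ₁ = 0`, `dΦ₂ = 0` and `dη = 2Φ₃`. -/
structure IsDoubleAqSSasakian (φ₁ φ₂ φ₃ : Π x : M, TangentSpace I x →L[ℝ] TangentSpace I x)
    (ξ : Π x : M, TangentSpace I x) (η : Π x : M, TangentSpace I x →L[ℝ] ℝ) : Prop
    extends IsSpAlmostContactMetric g φ₁ φ₂ φ₃ ξ η where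
  closed₁ : IsClosedTwoForm (fundamentalForm g φ₁)
  closed₂ : IsClosedTwoForm (fundamentalForm g φ₂)
  deta : ∀ (x : M) (X Y : Π x : M, TangentSpace I x), SmoothAt X x → SmoothAt Y x →
    extDerivOne η X Y x = 2 * fundamentalForm g φ₃ x (X x) (Y x)

end AlmostContact

end

open AlmostContact

/-! Write P for ∇ξ. The η-component of the condition on N_φ gives dη(φX, φY) = -dη(X, Y). Since φξ =
0, taking Y = ξ gives dη(·, ξ) = 0, hence Pξ = 0, and also ℒ_ξ φ = 0. Together with dΦ = 0 this
makes ξ Killing (`killing`), so dη(X, Y) = 2 g(PX, Y) and P anticommutes with φ (`leviCivita_phi`).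
Hence ψ = -P and ψ² = A² = P² on every aqS manifold.

A unit Killing field satisfies K(ξ, u) = |Pu|² (`sectionalCurvature_killing`). So (a) says that P is
isometric on the orthogonal complement of ξ; as P is skew, polarization turns this into P² = -I + η
⊗ ξ, which is (b). The algebraic part of (c) then follows from the relations between P and φ.

The remaining point is dΦ₁ = 0, which holds without (a) or (b). One has Φ₁(X, Y) = β(φX, Y) with β =
-½ dη closed and β(φX, φY) = -β(X, Y). As for the real and imaginary parts of a form of type (2, 0),
integrability of φ modulo ξ carries closedness from β to Φ₁ (`extDerivTwo_comp_eq_zero`). -/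

namespace AlmostContact

open Filter Topology

variable {E : Type*} [NormedAddCommGroup E] [NormedSpace ℝ E] [FiniteDimensional ℝ E]
  {H : Type*} [TopologicalSpace H] {I : ModelWithCorners ℝ E H}
  {M : Type*} [TopologicalSpace M] [ChartedSpace H M] [IsManifold I ∞ M]
  {g : ContMDiffRiemannianMetric I ∞ E (fun x : M ↦ TangentSpace I x)}

/-! ### Calculus of vector fields smooth at a point. -/

namespace SmoothAt

variable {X Y Z : Π x : M, TangentSpace I x} {x : M}

theorem mdifferentiableAt (hX : SmoothAt X x) : MDiffAt (T% X) x :=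
  ContMDiffAt.mdifferentiableAt hX (by simp)

theorem eventually_mdifferentiableAt (hX : SmoothAt X x) : ∀ᶠ y in 𝓝 x, MDiffAt (T% X) y := by
  have h1 : CMDiffAt 1 (T% X) x := ContMDiffAt.of_le hX (by simp)
  filter_upwards [(contMDiffAt_iff_contMDiffAt_nhds (by simp)).1 h1] with y hy
  exact hy.mdifferentiableAt (by simp)

theorem contMDiffAt_two (hX : SmoothAt X x) : CMDiffAt (minSmoothness ℝ 2) (T% X) x :=
  ContMDiffAt.of_le hX (by simpa using ENat.LEInfty.out)

theorem congr (hX : SmoothAt X x) (h : Y =ᶠ[𝓝 x] X) : SmoothAt Y x := by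
  refine ContMDiffAt.congr_of_eventuallyEq hX ?_
  filter_upwards [h] with y hy
  rw [hy]

theorem mlieBracket (hX : SmoothAt X x) (hY : SmoothAt Y x) : SmoothAt (mlieBracket I X Y) x := by
  have : IsManifold I (((⊤ : ℕ∞) : WithTop ℕ∞) + 1) M := by
    simpa using (inferInstance : IsManifold I ∞ M)
  have : IsManifold I (minSmoothness ℝ 2) M := by simpa using (inferInstance : IsManifold I 2 M)
  exact ContMDiffAt.mlieBracket_vectorField (n := ⊤) (m := ⊤) hX hY (by simp)

theorem smul {f : M → ℝ} (hf : CMDiffAt ∞ f x) (hX : SmoothAt X x) : SmoothAt (f • X) x :=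
  ContMDiffAt.smul_section hf hX

theorem inner (hX : SmoothAt X x) (hY : SmoothAt Y x) :
    CMDiffAt ∞ (fun y ↦ g.inner y (X y) (Y y)) x := by
  have h : ContMDiffAt I (I.prod 𝓘(ℝ)) ∞
      (fun m ↦ TotalSpace.mk' ℝ (E := Bundle.Trivial M ℝ) m (g.inner m (X m) (Y m))) x := by
    apply ContMDiffAt.clm_bundle_apply₂ (F₁ := E) (F₂ := E)
    · exact g.contMDiff.contMDiffAt
    · exact hX
    · exact hY
  simp only [contMDiffAt_totalSpace] at h
  exact h.2

theorem endo_apply {φ : Π x : M, TangentSpace I x →L[ℝ] TangentSpace I x}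
    (hφ : ContMDiffAt I (I.prod 𝓘(ℝ, E →L[ℝ] E)) ∞
    (fun x ↦ TotalSpace.mk' (E →L[ℝ] E)
      (E := fun x : M ↦ TangentSpace I x →L[ℝ] TangentSpace I x) x (φ x)) x)
    (hX : SmoothAt X x) : SmoothAt (fun y ↦ φ y (X y)) x :=
  ContMDiffAt.clm_bundle_apply (F₁ := E) (F₂ := E) hφ hX

theorem form_apply {η : Π x : M, TangentSpace I x →L[ℝ] ℝ}
    (hη : ContMDiffAt I (I.prod 𝓘(ℝ, E →L[ℝ] ℝ)) ∞
    (fun x ↦ TotalSpace.mk' (E →L[ℝ] ℝ)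
      (E := fun x : M ↦ TangentSpace I x →L[ℝ] Bundle.Trivial M ℝ x) x (η x)) x)
    (hX : SmoothAt X x) : CMDiffAt ∞ (fun y ↦ η y (X y)) x := by
  have h : ContMDiffAt I (I.prod 𝓘(ℝ)) ∞
      (fun m ↦ TotalSpace.mk' ℝ (E := Bundle.Trivial M ℝ) m (η m (X m))) x :=
    ContMDiffAt.clm_bundle_apply (F₁ := E) (F₂ := ℝ) hη hX
  simp only [contMDiffAt_totalSpace] at h
  exact h.2

theorem mvfderiv {f : M → ℝ} (hf : CMDiffAt ∞ f x) (hX : SmoothAt X x) :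
    CMDiffAt ∞ (fun y ↦ mvfderiv I f y (X y)) x := by
  have h1 := hf.mfderiv_const (m := ∞) (by simp)
  have h2 := ContMDiffAt.clm_apply_of_inCoordinates (F₁ := E) (E₁ := fun x : M ↦ TangentSpace I x)
    (F₂ := ℝ) (E₂ := fun x : ℝ ↦ TangentSpace 𝓘(ℝ, ℝ) x) (v := X) h1 hX hf
  rw [contMDiffAt_totalSpace] at h2
  have h3 := h2.2
  simp only [trivializationAt_model_space_apply] at h3
  exact h3

end SmoothAt

theorem smoothAt_extend {x : M} (v : TangentSpace I x) : SmoothAt (FiberBundle.extend E v) x :=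
  FiberBundle.contMDiffAt_extend ..


/-! ### Testing smoothness of tensor fields on vector fields. -/

/-- A basis of the finite-dimensional source identifies F →L G with a power of G, where smoothness
is componentwise. -/
theorem contMDiffAt_clm_of_apply {F G : Type*} [NormedAddCommGroup F] [NormedSpace ℝ F]
    [FiniteDimensional ℝ F] [NormedAddCommGroup G] [NormedSpace ℝ G] {f : M → F →L[ℝ] G} {x : M}
    (h : ∀ v, CMDiffAt ∞ (fun y ↦ f y v) x) : CMDiffAt ∞ f x := by
  let d := Module.finrank ℝ F
  have hd : d = Module.finrank ℝ (Fin d → ℝ) := (Module.finrank_fin_fun ℝ).symm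
  let e₁ := ContinuousLinearEquiv.ofFinrankEq hd
  let e₂ := (e₁.arrowCongr (1 : G ≃L[ℝ] G)).trans (ContinuousLinearEquiv.piRing (Fin d))
  have h₂ : ContMDiffAt I 𝓘(ℝ, Fin d → G) ∞ (fun y ↦ e₂ (f y)) x :=
    contMDiffAt_pi_space.2 fun i ↦ h _
  have := (e₂.symm.contDiff (n := ∞)).contMDiff.contMDiffAt.comp x h₂
  simpa [Function.comp_def] using this

theorem isInvertible_of_injective {F G : Type*} [NormedAddCommGroup F] [NormedSpace ℝ F]
    [FiniteDimensional ℝ F] [NormedAddCommGroup G] [NormedSpace ℝ G] [FiniteDimensional ℝ G]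
    {f : F →L[ℝ] G}
    (h : Module.finrank ℝ F = Module.finrank ℝ G) (hf : Function.Injective f) :
    f.IsInvertible :=
  ⟨(LinearMap.linearEquivOfInjective f.toLinearMap hf h).toContinuousLinearEquiv, by ext; rfl⟩

theorem finrank_clm_dual : Module.finrank ℝ (E →L[ℝ] ℝ) = Module.finrank ℝ E := by
  rw [← (LinearMap.toContinuousLinearMap (𝕜 := ℝ) (E := E) (F' := ℝ)).finrank_eq]
  exact Subspace.dual_finrank_eq

/-- Fields constant in the trivialization at `x` supply the local frames on which tensors are tested
below. -/
theorem smoothAt_symmL (x : M) (v : E) :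
    SmoothAt (fun y ↦ (trivializationAt E (TangentSpace I : M → Type _) x).symmL ℝ y v) x := by
  let t := trivializationAt E (TangentSpace I : M → Type _) x
  have hx : x ∈ t.baseSet := FiberBundle.mem_baseSet_trivializationAt' x
  refine (smoothAt_extend (t.symm x v)).congr ?_
  filter_upwards [t.open_baseSet.mem_nhds hx] with y hy
  rw [t.symmL_apply hy]
  simp [FiberBundle.extend, t, t.apply_mk_symm hx]
  rfl

/-- A vector field is smooth if its products with all smooth vector fields are smooth. -/
theorem smoothAt_of_inner {V : Π x : M, TangentSpace I x} {x : M}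
    (h : ∀ W : Π x : M, TangentSpace I x, SmoothAt W x →
      CMDiffAt ∞ (fun y ↦ g.inner y (V y) (W y)) x) : SmoothAt V x := by
  let t := trivializationAt E (TangentSpace I : M → Type _) x
  have hx : x ∈ t.baseSet := FiberBundle.mem_baseSet_trivializationAt' x
  -- In the trivialization, `G` is the Gram form and `B` the covector of `V`. The coordinates of `V`
  -- are G⁻¹B, and inversion is smooth at invertible maps.
  let G : M → E →L[ℝ] E →L[ℝ] ℝ := fun y ↦ ((t.symmL ℝ y).precomp ℝ) ∘L (g.inner y) ∘L (t.symmL ℝ y)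
  let B : M → E →L[ℝ] ℝ := fun y ↦ (g.inner y (V y)).comp (t.symmL ℝ y)
  have hG : CMDiffAt ∞ G x := contMDiffAt_clm_of_apply fun v ↦ contMDiffAt_clm_of_apply fun w ↦
    (smoothAt_symmL x v).inner (smoothAt_symmL x w)
  have hB : CMDiffAt ∞ B x := contMDiffAt_clm_of_apply fun v ↦ h _ (smoothAt_symmL x v)
  have hinv : ∀ y ∈ t.baseSet, (G y).IsInvertible := by
    intro y hy
    refine isInvertible_of_injective finrank_clm_dual.symm ?_
    rw [injective_iff_map_eq_zero]
    intro v hv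
    by_contra hne
    have h0 : t.symmL ℝ y v ≠ 0 := by
      intro h0
      apply hne
      have := t.continuousLinearMapAt_symmL (R := ℝ) hy v
      rw [← this, h0, map_zero]
    have := g.pos y _ h0
    have h2 : G y v v = 0 := by rw [hv]; rfl
    exact this.ne' h2
  have key : ∀ y ∈ t.baseSet, (t ⟨y, V y⟩).2 = (G y).inverse (B y) := by
    intro y hy
    have e : B y = G y (t ⟨y, V y⟩).2 := by
      ext w
      have := t.symmL_continuousLinearMapAt (R := ℝ) hy (V y)
      rw [Trivialization.continuousLinearMapAt_apply, t.linearMapAt_apply, if_pos hy] at this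
      simp only [G, B, ContinuousLinearMap.precomp_apply, ContinuousLinearMap.comp_apply]
      rw [this]
    obtain ⟨L, hL⟩ := hinv y hy
    rw [e, ← hL]
    simp
  rw [SmoothAt, contMDiffAt_section]
  have hI : CMDiffAt ∞ (fun y ↦ (G y).inverse) x := by
    obtain ⟨L, hL⟩ := hinv x hx
    refine ContMDiffAt.comp (g := ContinuousLinearMap.inverse) x ?_ hG
    rw [← hL]
    exact (contDiffAt_map_inverse L).contMDiffAt
  refine (hI.clm_apply hB).congr_of_eventuallyEq ?_
  filter_upwards [t.open_baseSet.mem_nhds hx] with y hy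
  exact key y hy

/-- A field of endomorphisms is smooth if its values on smooth vector fields are smooth. -/
theorem contMDiffAt_endo_of_apply {φ : Π x : M, TangentSpace I x →L[ℝ] TangentSpace I x} {x : M}
    (h : ∀ W : Π x : M, TangentSpace I x, SmoothAt W x → SmoothAt (fun y ↦ φ y (W y)) x) :
    ContMDiffAt I (I.prod 𝓘(ℝ, E →L[ℝ] E)) ∞
    (fun x ↦ TotalSpace.mk' (E →L[ℝ] E)
      (E := fun x : M ↦ TangentSpace I x →L[ℝ] TangentSpace I x) x (φ x)) x := by
  rw [contMDiffAt_hom_bundle]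
  refine ⟨contMDiffAt_id, contMDiffAt_clm_of_apply fun v ↦ ?_⟩
  have hv := h _ (smoothAt_symmL x v)
  rw [SmoothAt, contMDiffAt_section] at hv
  refine hv.congr_of_eventuallyEq ?_
  let t := trivializationAt E (TangentSpace I : M → Type _) x
  have hx : x ∈ t.baseSet := FiberBundle.mem_baseSet_trivializationAt' x
  filter_upwards [t.open_baseSet.mem_nhds hx] with y hy
  simp only [ContinuousLinearMap.inCoordinates, ContinuousLinearMap.comp_apply]
  rw [Trivialization.continuousLinearMapAt_apply, Trivialization.linearMapAt_apply, if_pos hy]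

/-! ### Brackets as commutators of derivations; smoothness of ∇. -/

variable {X Y Z : Π x : M, TangentSpace I x} {x : M}

theorem mvfderiv_congr {f f' : M → ℝ} (h : f =ᶠ[𝓝 x] f') :
    mvfderiv I f x = mvfderiv I f' x := by
  ext v
  have := h.mfderiv_eq (I := I) (I' := 𝓘(ℝ))
  change mfderiv I 𝓘(ℝ) f x v = mfderiv I 𝓘(ℝ) f' x v
  rw [this]
  rfl

theorem eventually_mdifferentiableAt_of_contMDiffAt {f : M → ℝ} (hf : CMDiffAt ∞ f x) :
    ∀ᶠ y in 𝓝 x, MDiffAt f y := by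
  have h1 : CMDiffAt 1 f x := ContMDiffAt.of_le hf (by simp)
  filter_upwards [(contMDiffAt_iff_contMDiffAt_nhds (by simp)).1 h1] with y hy
  exact hy.mdifferentiableAt (by simp)

theorem eventuallyEq_mlieBracket_smul_right {f : M → ℝ} (hf : CMDiffAt ∞ f x) (hY : SmoothAt Y x) :
    mlieBracket I X (f • Y) =ᶠ[𝓝 x]
      (fun y ↦ mvfderiv I f y (X y)) • Y + f • mlieBracket I X Y := by
  filter_upwards [eventually_mdifferentiableAt_of_contMDiffAt hf,
    hY.eventually_mdifferentiableAt] with y hf hY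
  rw [VectorField.mlieBracket_smul_right hf hY]
  rfl

/-- Compare the Jacobi identity for X, Y, fZ with f times the one for X, Y, Z. The terms in [X, Z]
and [Y, Z] cancel, and what remains is the asserted difference times Z. A field Z with Z(x) ≠ 0
finishes; if the tangent space is zero, both sides vanish. -/
theorem mvfderiv_mlieBracket {f : M → ℝ} (hf : CMDiffAt ∞ f x) (hX : SmoothAt X x)
    (hY : SmoothAt Y x) :
    mvfderiv I f x (mlieBracket I X Y x) =
      mvfderiv I (fun y ↦ mvfderiv I f y (Y y)) x (X x)
        - mvfderiv I (fun y ↦ mvfderiv I f y (X y)) x (Y x) := by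
  have : IsManifold I (minSmoothness ℝ 3) M := by simpa using (inferInstance : IsManifold I 3 M)
  by_cases h0 : ∀ z : TangentSpace I x, z = 0
  · simp [h0 (X x), h0 (Y x), h0 (mlieBracket I X Y x)]
  push Not at h0
  obtain ⟨z, hz⟩ := h0
  have hZ := smoothAt_extend z
  set Z : Π x : M, TangentSpace I x := FiberBundle.extend E z with hZdef
  have hZx : Z x = z := FiberBundle.extend_apply_self ..
  have hXf := SmoothAt.mvfderiv hf hX
  have hYf := SmoothAt.mvfderiv hf hY
  have key := leibniz_identity_mlieBracket_apply hX.contMDiffAt_two hY.contMDiffAt_two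
    (SmoothAt.smul hf hZ).contMDiffAt_two
  have jac := leibniz_identity_mlieBracket_apply hX.contMDiffAt_two hY.contMDiffAt_two
    hZ.contMDiffAt_two
  have expand : ∀ {A B : Π x : M, TangentSpace I x}, SmoothAt A x → SmoothAt B x →
      mlieBracket I A (mlieBracket I B (f • Z)) x =
        mvfderiv I (fun y ↦ mvfderiv I f y (B y)) x (A x) • Z x
        + mvfderiv I f x (B x) • mlieBracket I A Z x
        + (mvfderiv I f x (A x) • mlieBracket I B Z x
        + f x • mlieBracket I A (mlieBracket I B Z) x) := by
    intro A B hA hB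
    have hBf := SmoothAt.mvfderiv hf hB
    rw [(EventuallyEq.refl _ A).mlieBracket_vectorField_eq (eventuallyEq_mlieBracket_smul_right hf hZ),
      mlieBracket_add_right (SmoothAt.smul hBf hZ).mdifferentiableAt
        (SmoothAt.smul hf (hB.mlieBracket hZ)).mdifferentiableAt,
      VectorField.mlieBracket_smul_right (hBf.mdifferentiableAt (by simp)) hZ.mdifferentiableAt,
      VectorField.mlieBracket_smul_right (hf.mdifferentiableAt (by simp))
        (hB.mlieBracket hZ).mdifferentiableAt]
  rw [expand hX hY, expand hY hX, VectorField.mlieBracket_smul_right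
    (hf.mdifferentiableAt (by simp)) hZ.mdifferentiableAt, jac] at key
  have h2 : (mvfderiv I f x (mlieBracket I X Y x) -
      (mvfderiv I (fun y ↦ mvfderiv I f y (Y y)) x (X x)
        - mvfderiv I (fun y ↦ mvfderiv I f y (X y)) x (Y x))) • z = 0 := by
    rw [← hZx]
    rw [smul_add] at key
    linear_combination (norm := module) (-1 : ℝ) • key
  rcases smul_eq_zero.1 h2 with h | h
  · linarith
  · exact absurd h hz

/-- `∇_X Y - ∇_Y X = [X, Y]`. -/
theorem mlieBracket_eq_leviCivita (hX : MDiffAt (T% X) x) (hY : MDiffAt (T% Y) x) :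
    mlieBracket I X Y x = leviCivita g Y x (X x) - leviCivita g X x (Y x) :=
  ((CovariantDerivative.torsion_eq_zero_iff (leviCivita g)).1 leviCivita_torsion hX hY).symm

/-- The Koszul formula makes every product of ∇_X Y with a smooth field smooth. -/
theorem SmoothAt.leviCivita (hX : SmoothAt X x) (hY : SmoothAt Y x) :
    SmoothAt (fun y ↦ leviCivita g Y y (X y)) x := by
  refine smoothAt_of_inner (g := g) fun Z hZ ↦ ?_
  have h : CMDiffAt ∞ (fun y ↦ 2⁻¹ * koszul g X Y Z y) x := by
    refine contMDiffAt_const.mul ?_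
    exact (((((SmoothAt.mvfderiv (hY.inner hZ) hX).add (SmoothAt.mvfderiv (hZ.inner hX) hY)).sub
      (SmoothAt.mvfderiv (hX.inner hY) hZ)).add ((hX.mlieBracket hY).inner hZ)).sub
      ((hX.mlieBracket hZ).inner hY)).sub ((hY.mlieBracket hZ).inner hX)
  refine h.congr_of_eventuallyEq ?_
  filter_upwards [hX.eventually_mdifferentiableAt, hY.eventually_mdifferentiableAt,
    hZ.eventually_mdifferentiableAt] with y hX hY hZ
  exact metric_leviCivita hX hY hZ

/-! ### Unit Killing vector fields -/

variable {ξ : Π x : M, TangentSpace I x}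

theorem inner_leviCivita_self (hξ : MDiffAt (T% ξ) x) (h1 : ∀ x, g.inner x (ξ x) (ξ x) = 1)
    (v : TangentSpace I x) : g.inner x (leviCivita g ξ x v) (ξ x) = 0 := by
  have hv := FiberBundle.mdifferentiableAt_extend I E v
  have := leviCivita_metric (g := g) hv hξ hξ
  simp only [h1, mvfderiv_const, FiberBundle.extend_apply_self, zero_apply] at this
  rw [g.symm x (ξ x)] at this
  linarith

theorem leviCivita_self_eq_zero (hξ : MDiffAt (T% ξ) x) (h1 : ∀ x, g.inner x (ξ x) (ξ x) = 1)
    (hK : ∀ v w : TangentSpace I x,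
      g.inner x (leviCivita g ξ x v) w = -g.inner x v (leviCivita g ξ x w)) :
    leviCivita g ξ x (ξ x) = 0 := by
  refine metric_ext (g := g) fun Z _ ↦ ?_
  rw [hK, g.symm, inner_leviCivita_self hξ h1]
  simp

/-- The sectional curvature of a plane through a unit Killing vector field. -/
theorem sectionalCurvature_killing (hξ : ∀ x, SmoothAt ξ x)
    (h1 : ∀ x, g.inner x (ξ x) (ξ x) = 1)
    (hK : ∀ (x : M) (v w : TangentSpace I x),
      g.inner x (leviCivita g ξ x v) w = -g.inner x v (leviCivita g ξ x w))
    (x : M) (u : TangentSpace I x) :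
    sectionalCurvature g x (ξ x) u
      = g.inner x (leviCivita g ξ x u) (leviCivita g ξ x u) := by
  have hX := smoothAt_extend (ξ x)
  have hU := smoothAt_extend u
  have eX : FiberBundle.extend E (ξ x) x = ξ x := FiberBundle.extend_apply_self ..
  have eU : FiberBundle.extend E u x = u := FiberBundle.extend_apply_self ..
  rw [sectionalCurvature, curvature, curvatureField]
  -- `X` is only known to equal `ξ` at `x`, so the two may not be exchanged under a derivative.
  set X : Π x : M, TangentSpace I x := FiberBundle.extend E (ξ x)
  set U : Π x : M, TangentSpace I x := FiberBundle.extend E u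
  rw [← eU]
  have hd := fun {Y : Π x : M, TangentSpace I x} (h : SmoothAt Y x) ↦ h.mdifferentiableAt
  have hUU := hU.leviCivita (g := g) hU
  have hXU := hX.leviCivita (g := g) hU
  have hUξ := hU.leviCivita (g := g) (hξ x)
  have hXξ := hX.leviCivita (g := g) (hξ x)
  -- With f = g(U, ξ), skewness gives g(∇_U U, ξ) = Uf, while g(∇_X U, ξ) = Xf - g(U, ∇_X ξ). In
  -- g(R(X, U)U, ξ) the second derivatives of f cancel against [X, U]f. By skewness and vanishing
  -- torsion the rest reduces to -g(ξ, ∇_U ∇_U ξ), which is |∇_U ξ|² because g(ξ, ∇_U ξ) = 0.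
  have hf : CMDiffAt ∞ (fun y ↦ g.inner y (U y) (ξ y)) x := hU.inner (hξ x)
  have hg : CMDiffAt ∞ (fun y ↦ g.inner y (U y) (leviCivita g ξ y (X y))) x := hU.inner hXξ
  have a1 := leviCivita_metric (g := g) (hd hX) (hd hUU) (hd (hξ x))
  have a2 := leviCivita_metric (g := g) (hd hU) (hd hXU) (hd (hξ x))
  have a3 := leviCivita_metric (g := g) (hd (hX.mlieBracket hU)) (hd hU) (hd (hξ x))
  have a4 := leviCivita_metric (g := g) (hd hU) (hd hX) (hd hUξ)
  have a5 := leviCivita_metric (g := g) (hd hU) (hd (hξ x)) (hd hUξ)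
  have b1 : (fun y ↦ g.inner y (leviCivita g U y (U y)) (ξ y)) =ᶠ[𝓝 x]
      fun y ↦ mvfderiv I (fun y ↦ g.inner y (U y) (ξ y)) y (U y) := by
    filter_upwards [hU.eventually_mdifferentiableAt] with y hy
    have h2 := hK y (U y) (U y)
    rw [g.symm] at h2
    rw [leviCivita_metric (g := g) hy hy (hξ y).mdifferentiableAt]
    linarith
  have b2 : (fun y ↦ g.inner y (leviCivita g U y (X y)) (ξ y)) =ᶠ[𝓝 x]
      (fun y ↦ mvfderiv I (fun y ↦ g.inner y (U y) (ξ y)) y (X y))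
        - fun y ↦ g.inner y (U y) (leviCivita g ξ y (X y)) := by
    filter_upwards [hU.eventually_mdifferentiableAt, hX.eventually_mdifferentiableAt] with y hy hX
    simp only [Pi.sub_apply]
    rw [leviCivita_metric (g := g) hX hy (hξ y).mdifferentiableAt]
    ring
  have b4 : (fun y ↦ g.inner y (X y) (leviCivita g ξ y (U y)))
      = -fun y ↦ g.inner y (U y) (leviCivita g ξ y (X y)) := by
    ext y
    rw [Pi.neg_apply, ← hK, g.symm]
  have b5 : (fun y ↦ g.inner y (ξ y) (leviCivita g ξ y (U y))) = fun _ ↦ 0 := by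
    ext y
    rw [g.symm, inner_leviCivita_self (hξ y).mdifferentiableAt h1]
  rw [mvfderiv_congr b1] at a1
  rw [mvfderiv_congr b2, mvfderiv_sub ((SmoothAt.mvfderiv hf hX).mdifferentiableAt (by simp))
    (hg.mdifferentiableAt (by simp))] at a2
  rw [mvfderiv_mlieBracket hf hX hU] at a3
  rw [b4, mvfderiv_neg] at a4
  rw [b5, mvfderiv_const] at a5
  have c1 : leviCivita g ξ x (X x) = 0 := by
    rw [eX, leviCivita_self_eq_zero (hd (hξ x)) h1 (hK x)]
  have c2 := hK x (mlieBracket I X U x) (U x)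
  have c3 := mlieBracket_eq_leviCivita (g := g) (hd hX) (hd hU)
  rw [g.symm] at c2
  rw [c3] at c2
  simp only [map_sub, sub_apply, neg_apply, zero_apply] at a1 a2 a3 a4 a5 c2 ⊢
  rw [c3] at a3 ⊢
  simp only [map_sub, sub_apply] at a3 ⊢
  rw [c1] at a1
  simp only [eX, map_zero] at a1 a2 a3 a4 a5 c2 ⊢
  linarith

/-! ### Algebra of almost contact metric structures. -/

variable {φ : Π x : M, TangentSpace I x →L[ℝ] TangentSpace I x}
  {η : Π x : M, TangentSpace I x →L[ℝ] ℝ}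

namespace IsAlmostContactMetric

/-- Since φ²ξ = 0, also φ³ξ = 0, so φξ = cξ with c = η(φξ). Then cφξ = 0, and either factor being
zero suffices. -/
theorem phi_xi (h : IsAlmostContactMetric g φ ξ η) (x : M) : φ x (ξ x) = 0 := by
  have h1 : φ x (φ x (ξ x)) = 0 := by rw [h.phi_sq, h.eta_xi]; simp
  have h2 := h.phi_sq x (φ x (ξ x))
  rw [h1, map_zero] at h2
  have h3 : φ x (ξ x) = η x (φ x (ξ x)) • ξ x := by
    rw [eq_comm, neg_add_eq_zero] at h2
    exact h2
  rw [h3, map_smul, smul_eq_zero] at h1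
  rcases h1 with h1 | h1
  · rw [h3, h1, zero_smul]
  · exact h1

theorem eta_phi (h : IsAlmostContactMetric g φ ξ η) (x : M) (v : TangentSpace I x) :
    η x (φ x v) = 0 := by
  have h1 := h.phi_sq x (φ x v)
  rw [h.phi_sq x v, map_add, map_smul, h.phi_xi, map_neg, smul_zero, add_zero] at h1
  have h2 := congrArg (η x) h1
  simpa [h.eta_xi] using h2

theorem inner_xi (h : IsAlmostContactMetric g φ ξ η) (x : M) (v : TangentSpace I x) :
    g.inner x (ξ x) v = η x v := by
  have := h.compatible x (ξ x) v
  rw [h.phi_xi, h.eta_xi] at this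
  simp only [map_zero, zero_apply] at this
  linarith

theorem inner_xi_right (h : IsAlmostContactMetric g φ ξ η) (x : M) (v : TangentSpace I x) :
    g.inner x v (ξ x) = η x v := by
  rw [g.symm, h.inner_xi]

theorem inner_xi_self (h : IsAlmostContactMetric g φ ξ η) (x : M) :
    g.inner x (ξ x) (ξ x) = 1 := by
  rw [h.inner_xi, h.eta_xi]

theorem inner_phi_left (h : IsAlmostContactMetric g φ ξ η) (x : M) (v w : TangentSpace I x) :
    g.inner x (φ x v) w = -g.inner x v (φ x w) := by
  have := h.compatible x (φ x v) w
  rw [h.phi_sq, h.eta_phi] at this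
  simp only [map_add, map_neg, map_smul, add_apply, neg_apply, smul_apply, h.inner_xi, h.eta_phi,
    smul_zero] at this
  linarith

theorem smoothAt_xi (h : IsAlmostContactMetric g φ ξ η) (x : M) : SmoothAt ξ x :=
  h.smooth_xi.contMDiffAt

theorem smoothAt_phi (h : IsAlmostContactMetric g φ ξ η) (hX : SmoothAt X x) :
    SmoothAt (fun y ↦ φ y (X y)) x :=
  SmoothAt.endo_apply h.smooth_phi.contMDiffAt hX

theorem eta_leviCivita (h : IsAlmostContactMetric g φ ξ η) (x : M) (v : TangentSpace I x) :
    η x (leviCivita g ξ x v) = 0 := by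
  rw [← h.inner_xi_right]
  exact inner_leviCivita_self (h.smoothAt_xi x).mdifferentiableAt h.inner_xi_self v

/-- Differentiate η(Y) = g(ξ, Y); by vanishing torsion the derivatives of X and Y cancel against
η([X, Y]). -/
theorem extDerivOne_eq (h : IsAlmostContactMetric g φ ξ η)
    (hX : MDiffAt (T% X) x) (hY : MDiffAt (T% Y) x) :
    extDerivOne η X Y x
      = g.inner x (leviCivita g ξ x (X x)) (Y x) - g.inner x (leviCivita g ξ x (Y x)) (X x) := by
  have hξ := (h.smoothAt_xi x).mdifferentiableAt
  have e1 := leviCivita_metric (g := g) hX hξ hY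
  have e2 := leviCivita_metric (g := g) hY hξ hX
  simp only [h.inner_xi] at e1 e2
  rw [extDerivOne, e1, e2, mlieBracket_eq_leviCivita (g := g) hX hY, map_sub]
  ring

end IsAlmostContactMetric

/-! ### Closedness of two-forms. -/

/-- The exterior derivative of `c • dη` vanishes. -/
theorem extDerivTwo_extDerivOne {c : ℝ}
    (hη : ∀ {W : Π x : M, TangentSpace I x}, SmoothAt W x → CMDiffAt ∞ (fun y ↦ η y (W y)) x)
    {β : Π x : M, TangentSpace I x → TangentSpace I x → ℝ}
    (hβ : ∀ {V W : Π x : M, TangentSpace I x} {y : M}, MDiffAt (T% V) y → MDiffAt (T% W) y →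
      β y (V y) (W y) = c * extDerivOne η V W y)
    (hX : SmoothAt X x) (hY : SmoothAt Y x) (hZ : SmoothAt Z x) :
    extDerivTwo β X Y Z x = 0 := by
  -- In the cyclic sum of `D` minus `B`, all derivatives of functions cancel; only η of the cyclic
  -- sum of [[U, V], W] is left, and it vanishes by Jacobi.
  have D : ∀ {U V W : Π x : M, TangentSpace I x}, SmoothAt U x → SmoothAt V x → SmoothAt W x →
      mvfderiv I (fun y ↦ β y (V y) (W y)) x (U x)
        = c * (mvfderiv I (fun y ↦ mvfderiv I (fun z ↦ η z (W z)) y (V y)) x (U x)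
          - mvfderiv I (fun y ↦ mvfderiv I (fun z ↦ η z (V z)) y (W y)) x (U x)
          - mvfderiv I (fun y ↦ η y (mlieBracket I V W y)) x (U x)) := by
    intro U V W hU hV hW
    have e : (fun y ↦ β y (V y) (W y)) =ᶠ[𝓝 x]
        (fun _ ↦ c) * ((fun y ↦ mvfderiv I (fun z ↦ η z (W z)) y (V y))
          - (fun y ↦ mvfderiv I (fun z ↦ η z (V z)) y (W y))
          - fun y ↦ η y (mlieBracket I V W y)) := by
      filter_upwards [hV.eventually_mdifferentiableAt, hW.eventually_mdifferentiableAt]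
        with y hV hW
      exact hβ hV hW
    have d1 := (SmoothAt.mvfderiv (hη hW) hV).mdifferentiableAt (by simp)
    have d2 := (SmoothAt.mvfderiv (hη hV) hW).mdifferentiableAt (by simp)
    have d3 := (hη (hV.mlieBracket hW)).mdifferentiableAt (by simp)
    rw [mvfderiv_congr e, mvfderiv_mul mdifferentiableAt_const ((d1.sub d2).sub d3),
      mvfderiv_sub (d1.sub d2) d3, mvfderiv_sub d1 d2, mvfderiv_const, smul_zero, add_zero]
    rfl
  have B : ∀ {U V W : Π x : M, TangentSpace I x}, SmoothAt U x → SmoothAt V x → SmoothAt W x →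
      β x (mlieBracket I U V x) (W x)
        = c * (mvfderiv I (fun y ↦ mvfderiv I (fun z ↦ η z (W z)) y (V y)) x (U x)
          - mvfderiv I (fun y ↦ mvfderiv I (fun z ↦ η z (W z)) y (U y)) x (V x)
          - mvfderiv I (fun y ↦ η y (mlieBracket I U V y)) x (W x)
          - η x (mlieBracket I (mlieBracket I U V) W x)) := by
    intro U V W hU hV hW
    rw [hβ (hU.mlieBracket hV).mdifferentiableAt hW.mdifferentiableAt, extDerivOne,
      mvfderiv_mlieBracket (hη hW) hU hV]
  have : IsManifold I (minSmoothness ℝ 3) M := by simpa using (inferInstance : IsManifold I 3 M)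
  have jac := leibniz_identity_mlieBracket_apply hX.contMDiffAt_two hY.contMDiffAt_two
    hZ.contMDiffAt_two
  have s1 := mlieBracket_swap_apply (I := I) (V := X) (W := mlieBracket I Y Z) (x := x)
  have s2 := mlieBracket_swap_apply (I := I) (V := Y) (W := mlieBracket I X Z) (x := x)
  have s3 : mlieBracket I (mlieBracket I X Z) Y x = -mlieBracket I (mlieBracket I Z X) Y x := by
    rw [mlieBracket_swap (V := X) (W := Z)]
    have : -mlieBracket I Z X = (-1 : ℝ) • mlieBracket I Z X := by simp
    rw [this, mlieBracket_const_smul_left (hZ.mlieBracket hX).mdifferentiableAt]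
    simp
  rw [s1, s2, s3] at jac
  have jac' := congrArg (η x) jac
  simp only [map_add, map_neg, neg_neg] at jac'
  rw [extDerivTwo, D hX hY hZ, D hY hZ hX, D hZ hX hY, B hX hY hZ, B hY hZ hX, B hZ hX hY]
  linear_combination (-c) * jac'

/-- If `dβ = 0` for a 2-form `β` with `β(φX, φY) = -β(X, Y)` and `φ` is integrable up to a field
`ξ` in the kernel of `β`, then the 2-form `β(φX, Y)` is closed. -/
theorem extDerivTwo_comp_eq_zero {β : Π x : M, TangentSpace I x →L[ℝ] TangentSpace I x →L[ℝ] ℝ}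
    {c : (Π x : M, TangentSpace I x) → (Π x : M, TangentSpace I x) → M → ℝ}
    (hφ : ∀ {W : Π x : M, TangentSpace I x}, SmoothAt W x → SmoothAt (fun y ↦ φ y (W y)) x)
    (hβ : ∀ {U V W : Π x : M, TangentSpace I x}, SmoothAt U x → SmoothAt V x → SmoothAt W x →
      extDerivTwo (fun x v w ↦ β x v w) U V W x = 0)
    (hswap : ∀ (x : M) (v w : TangentSpace I x), β x (φ x v) w = β x v (φ x w))
    (hanti : ∀ (x : M) (v w : TangentSpace I x), β x (φ x v) (φ x w) = -β x v w)
    (hξ : ∀ (x : M) (w : TangentSpace I x), β x (ξ x) w = 0)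
    (hN : ∀ {V W : Π x : M, TangentSpace I x}, SmoothAt V x → SmoothAt W x →
      mlieBracket I (fun y ↦ φ y (V y)) (fun y ↦ φ y (W y)) x
        = -φ x (φ x (mlieBracket I V W x)) + φ x (mlieBracket I V (fun y ↦ φ y (W y)) x)
          + φ x (mlieBracket I (fun y ↦ φ y (V y)) W x) + c V W x • ξ x)
    (hX : SmoothAt X x) (hY : SmoothAt Y x) (hZ : SmoothAt Z x) :
    extDerivTwo (fun x v w ↦ β x (φ x v) w) X Y Z x = 0 := by
  have D : ∀ U V W : Π x : M, TangentSpace I x,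
      mvfderiv I (fun y ↦ β y (φ y (V y)) (φ y (W y))) x (U x)
        = -mvfderiv I (fun y ↦ β y (V y) (W y)) x (U x) := by
    intro U V W
    have e : (fun y ↦ β y (φ y (V y)) (φ y (W y))) = -fun y ↦ β y (V y) (W y) := by
      ext y
      exact hanti ..
    rw [e, mvfderiv_neg]
    rfl
  have B : ∀ {U V W : Π x : M, TangentSpace I x}, SmoothAt U x → SmoothAt V x →
      β x (mlieBracket I (fun y ↦ φ y (U y)) (fun y ↦ φ y (V y)) x) (φ x (W x))
        = β x (φ x (mlieBracket I U V x)) (W x)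
          - β x (mlieBracket I U (fun y ↦ φ y (V y)) x) (W x)
          - β x (mlieBracket I (fun y ↦ φ y (U y)) V x) (W x) := by
    intro U V W hU hV
    rw [hN hU hV]
    simp only [map_add, map_neg, map_smul, add_apply, neg_apply, smul_apply, hanti, hξ, smul_zero]
    ring
  -- For γ(v, w) = β(φv, w), these four values of dβ add up to 2 dγ(X, Y, Z). The derivatives along
  -- φX, φY, φZ and the brackets with exactly one φ cancel between the last value and the first
  -- three.
  have h1 := hβ (hφ hX) hY hZ
  have h2 := hβ hX (hφ hY) hZ
  have h3 := hβ hX hY (hφ hZ)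
  have h4 := hβ (hφ hX) (hφ hY) (hφ hZ)
  simp only [extDerivTwo] at h1 h2 h3 h4 ⊢
  have D1 := D (fun y ↦ φ y (X y)) Y Z
  have D2 := D (fun y ↦ φ y (Y y)) Z X
  have D3 := D (fun y ↦ φ y (Z y)) X Y
  rw [D1, D2, D3, B hX hY, B hY hZ, B hZ hX] at h4
  simp only [← hswap] at h1 h2 h3
  linarith

/-! ### The characteristic field of an anti-quasi-Sasakian manifold. -/

namespace IsAntiQuasiSasakian

/-- Integrability of `φ` up to the characteristic direction. -/
theorem mlieBracket_phi_phi (h : IsAntiQuasiSasakian g φ ξ η) (hX : SmoothAt X x)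
    (hY : SmoothAt Y x) :
    mlieBracket I (fun y ↦ φ y (X y)) (fun y ↦ φ y (Y y)) x
      = -φ x (φ x (mlieBracket I X Y x)) + φ x (mlieBracket I X (fun y ↦ φ y (Y y)) x)
        + φ x (mlieBracket I (fun y ↦ φ y (X y)) Y x) + extDerivOne η X Y x • ξ x := by
  have := h.antiNormal x X Y hX hY
  rw [normalityTensor] at this
  linear_combination (norm := module) this

/-- As η ∘ φ = 0, only -η([φX, φY]) survives on the left, and the bracket identity determines it. -/
theorem extDerivOne_phi_phi (h : IsAntiQuasiSasakian g φ ξ η) (hX : SmoothAt X x)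
    (hY : SmoothAt Y x) :
    extDerivOne η (fun y ↦ φ y (X y)) (fun y ↦ φ y (Y y)) x = -extDerivOne η X Y x := by
  rw [extDerivOne, h.mlieBracket_phi_phi hX hY]
  simp [h.eta_phi, h.eta_xi, mvfderiv_const]

/-- For Y = ξ the bracket identity loses its terms in φY; its ξ-component and the remainder give the
two claims. -/
theorem mlieBracket_xi (h : IsAntiQuasiSasakian g φ ξ η) (hX : SmoothAt X x) :
    extDerivOne η X ξ x = 0 ∧
      φ x (φ x (mlieBracket I X ξ x)) = φ x (mlieBracket I (fun y ↦ φ y (X y)) ξ x) := by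
  have h1 := h.mlieBracket_phi_phi hX (h.smoothAt_xi x)
  have e : (fun y ↦ φ y (ξ y)) = 0 := by
    ext1 y
    exact h.phi_xi y
  rw [e, mlieBracket_zero_right, mlieBracket_zero_right] at h1
  simp only [Pi.zero_apply, map_zero, add_zero] at h1
  have h2 := congrArg (η x) h1
  simp only [map_add, map_neg, map_smul, h.eta_phi, h.eta_xi, map_zero, smul_eq_mul, mul_one,
    neg_zero, zero_add] at h2
  refine ⟨h2.symm, ?_⟩
  rw [← h2, zero_smul, add_zero, eq_comm, neg_add_eq_zero] at h1
  exact h1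

/-- `ℒ_ξ φ = 0`. -/
theorem mlieBracket_phi_xi (h : IsAntiQuasiSasakian g φ ξ η) (hX : SmoothAt X x) :
    mlieBracket I (fun y ↦ φ y (X y)) ξ x = φ x (mlieBracket I X ξ x) := by
  -- dη(φX, ξ) = 0 puts [φX, ξ] in the kernel of η, where φ² = -I, so φ can be cancelled.
  have h0 : η x (mlieBracket I (fun y ↦ φ y (X y)) ξ x) = 0 := by
    have := (h.mlieBracket_xi (h.smoothAt_phi hX)).1
    simpa [extDerivOne, h.eta_xi, h.eta_phi, mvfderiv_const] using this
  have h1 := congrArg (φ x) (h.mlieBracket_xi hX).2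
  rw [h.phi_sq, h.phi_sq, h0, h.eta_phi] at h1
  simpa using h1.symm

theorem leviCivita_xi (h : IsAntiQuasiSasakian g φ ξ η) (x : M) : leviCivita g ξ x (ξ x) = 0 := by
  refine metric_injective (g := g) x ?_
  ext v
  have hv := smoothAt_extend v
  have h1 := (h.mlieBracket_xi hv).1
  rw [h.extDerivOne_eq hv.mdifferentiableAt (h.smoothAt_xi x).mdifferentiableAt,
    h.inner_xi_right, h.eta_leviCivita] at h1
  simpa using h1

/-- The characteristic vector field of an anti-quasi-Sasakian manifold is Killing. -/
theorem killing (h : IsAntiQuasiSasakian g φ ξ η) (x : M) (v w : TangentSpace I x) :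
    g.inner x (leviCivita g ξ x v) w = -g.inner x v (leviCivita g ξ x w) := by
  -- dΦ(X, Y, ξ) = 0 is ℒ_ξ Φ = 0; with ℒ_ξ φ = 0 it yields skewness when one argument lies in the
  -- image of φ. The other directions are multiples of ξ, where both sides vanish.
  have key : ∀ v w : TangentSpace I x, g.inner x (leviCivita g ξ x v) (φ x w)
      = -g.inner x v (leviCivita g ξ x (φ x w)) := by
    intro v w
    have hX := smoothAt_extend v
    have hY := smoothAt_extend w
    have eX : FiberBundle.extend E v x = v := FiberBundle.extend_apply_self ..
    have eY : FiberBundle.extend E w x = w := FiberBundle.extend_apply_self ..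
    set X : Π x : M, TangentSpace I x := FiberBundle.extend E v
    set Y : Π x : M, TangentSpace I x := FiberBundle.extend E w
    have hξ := h.smoothAt_xi x
    have hφY := h.smoothAt_phi hY
    have c := h.closed x X Y ξ hX hY hξ
    have z1 : (fun y ↦ fundamentalForm g φ y (Y y) (ξ y)) = fun _ ↦ 0 := by
      ext y
      simp [fundamentalForm, h.phi_xi]
    have z2 : (fun y ↦ fundamentalForm g φ y (ξ y) (X y)) = fun _ ↦ 0 := by
      ext y
      simp [fundamentalForm, h.inner_xi, h.eta_phi]
    rw [extDerivTwo, z1, z2, mvfderiv_const] at c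
    simp only [fundamentalForm, h.phi_xi, map_zero, zero_apply] at c
    have m := leviCivita_metric (g := g) hξ.mdifferentiableAt hX.mdifferentiableAt
      hφY.mdifferentiableAt
    have t1 := mlieBracket_eq_leviCivita (g := g) hξ.mdifferentiableAt hX.mdifferentiableAt
    have t2 := mlieBracket_eq_leviCivita (g := g) hφY.mdifferentiableAt hξ.mdifferentiableAt
    rw [h.mlieBracket_phi_xi hY] at t2
    have s := h.inner_phi_left x (mlieBracket I Y ξ x) (X x)
    rw [g.symm, t2] at s
    rw [t1] at c
    simp only [map_sub, sub_apply] at c s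
    rw [← eX, ← eY]
    linarith
  have e := h.phi_sq x w
  have hw : w = η x w • ξ x - φ x (φ x w) := by rw [e]; module
  rw [hw]
  simp only [map_sub, map_smul, key, h.leviCivita_xi, h.inner_xi_right, h.eta_leviCivita]
  simp

theorem extDerivOne_eq_two_mul (h : IsAntiQuasiSasakian g φ ξ η)
    (hX : MDiffAt (T% X) x) (hY : MDiffAt (T% Y) x) :
    extDerivOne η X Y x = 2 * g.inner x (leviCivita g ξ x (X x)) (Y x) := by
  rw [h.extDerivOne_eq hX hY, h.killing x (Y x), g.symm x (Y x)]
  ring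

/-- Anti-invariance of dη reads g(Pφv, φw) = -g(Pv, w); the image of φ and ξ span the tangent space.
-/
theorem leviCivita_phi (h : IsAntiQuasiSasakian g φ ξ η) (x : M) (v : TangentSpace I x) :
    leviCivita g ξ x (φ x v) = -φ x (leviCivita g ξ x v) := by
  have key : ∀ w, g.inner x (leviCivita g ξ x (φ x v)) (φ x w)
      = -g.inner x (leviCivita g ξ x v) w := by
    intro w
    have hX := smoothAt_extend v
    have hY := smoothAt_extend w
    have := h.extDerivOne_phi_phi hX hY
    rw [h.extDerivOne_eq_two_mul (h.smoothAt_phi hX).mdifferentiableAt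
      (h.smoothAt_phi hY).mdifferentiableAt,
      h.extDerivOne_eq_two_mul hX.mdifferentiableAt hY.mdifferentiableAt] at this
    simp only [FiberBundle.extend_apply_self] at this
    linarith
  refine metric_injective (g := g) x ?_
  ext w
  have e := h.phi_sq x w
  have hw : w = η x w • ξ x - φ x (φ x w) := by rw [e]; module
  rw [hw]
  simp only [map_sub, map_smul, key, h.inner_xi_right, h.eta_leviCivita, map_neg, neg_apply,
    h.eta_phi, h.inner_phi_left]
  have := h.compatible x (leviCivita g ξ x v) (φ x w)
  simp only [h.inner_phi_left, h.eta_phi, h.eta_leviCivita] at this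
  simp only [neg_zero, smul_zero, neg_neg]
  linarith

/-! ### The operators A and ψ. -/

theorem operatorA_apply (x : M) (v : TangentSpace I x) :
    operatorA g φ ξ x v = -φ x (leviCivita g ξ x v) := rfl

theorem operatorPsi_apply (h : IsAntiQuasiSasakian g φ ξ η) (x : M) (v : TangentSpace I x) :
    operatorPsi g φ ξ x v = -leviCivita g ξ x v := by
  change operatorA g φ ξ x (φ x v) = _
  rw [operatorA_apply, h.leviCivita_phi, map_neg, h.phi_sq, h.eta_leviCivita]
  simp

theorem operatorA_sq (h : IsAntiQuasiSasakian g φ ξ η) (x : M) (v : TangentSpace I x) :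
    operatorA g φ ξ x (operatorA g φ ξ x v) = leviCivita g ξ x (leviCivita g ξ x v) := by
  rw [operatorA_apply, operatorA_apply, map_neg, map_neg, h.leviCivita_phi, map_neg, h.phi_sq,
    h.eta_leviCivita]
  simp

theorem operatorPsi_sq (h : IsAntiQuasiSasakian g φ ξ η) (x : M) (v : TangentSpace I x) :
    operatorPsi g φ ξ x (operatorPsi g φ ξ x v) = leviCivita g ξ x (leviCivita g ξ x v) := by
  rw [h.operatorPsi_apply, h.operatorPsi_apply]
  simp

theorem smoothAt_leviCivita_xi (h : IsAntiQuasiSasakian g φ ξ η) (hX : SmoothAt X x) :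
    SmoothAt (fun y ↦ leviCivita g ξ y (X y)) x :=
  hX.leviCivita (h.smoothAt_xi x)

/-- The fundamental form of `A` is closed. -/
theorem closed_operatorA (h : IsAntiQuasiSasakian g φ ξ η) :
    IsClosedTwoForm (fundamentalForm g (operatorA g φ ξ)) := by
  intro x X Y Z hX hY hZ
  -- This is -½ dη, which explains the constant `-2⁻¹` below.
  let β : Π x : M, TangentSpace I x →L[ℝ] TangentSpace I x →L[ℝ] ℝ :=
    fun x ↦ -(g.inner x ∘L leviCivita g ξ x)
  have hβ : ∀ (x : M) (v w : TangentSpace I x),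
      β x v w = -g.inner x (leviCivita g ξ x v) w := fun _ _ _ ↦ rfl
  have e : fundamentalForm g (operatorA g φ ξ) = fun x v w ↦ β x (φ x v) w := by
    ext x v w
    rw [fundamentalForm, operatorA_apply, hβ, h.killing, map_neg, h.inner_phi_left, neg_neg]
  rw [e]
  refine extDerivTwo_comp_eq_zero (c := extDerivOne η) h.smoothAt_phi ?_ ?_ ?_ ?_
    h.mlieBracket_phi_phi hX hY hZ
  · intro U V W hU hV hW
    refine extDerivTwo_extDerivOne (c := -2⁻¹) (η := η)
      (fun hW ↦ hW.form_apply h.smooth_eta.contMDiffAt) (fun {V W y} hV hW ↦ ?_) hU hV hW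
    rw [hβ, h.extDerivOne_eq_two_mul hV hW]
    ring
  · intro x v w
    rw [hβ, hβ, h.leviCivita_phi, map_neg, neg_apply, h.inner_phi_left]
    ring
  · intro x v w
    rw [hβ, hβ, h.leviCivita_phi, map_neg, neg_apply, h.compatible, h.eta_leviCivita]
    ring
  · intro x w
    rw [hβ, h.leviCivita_xi]
    simp

/-- `K(ξ, u) = 1` for all unit vectors `u` orthogonal to `ξ` if and only if
`A² = -I + η ⊗ ξ`. -/
theorem sectionalCurvature_xi_eq_one_iff (h : IsAntiQuasiSasakian g φ ξ η) (x : M) :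
    (∀ u : TangentSpace I x, η x u = 0 → g.inner x u u = 1 →
      sectionalCurvature g x (ξ x) u = 1) ↔
    ∀ v : TangentSpace I x,
      operatorA g φ ξ x (operatorA g φ ξ x v) = -v + η x v • ξ x := by
  simp only [sectionalCurvature_killing h.smoothAt_xi h.inner_xi_self h.killing, h.operatorA_sq]
  constructor
  · intro hK
    -- Rescaling extends the unit-vector condition to all vectors orthogonal to ξ; subtracting the
    -- ξ-component, which P kills, then reaches all vectors.
    have h0 : ∀ v : TangentSpace I x, η x v = 0 →
        g.inner x (leviCivita g ξ x v) (leviCivita g ξ x v) = g.inner x v v := by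
      intro v hv
      by_cases hv0 : v = 0
      · simp [hv0]
      have hpos := g.pos x v hv0
      have hs := Real.mul_self_sqrt hpos.le
      have hsne : √(g.inner x v v) ≠ 0 := (Real.sqrt_pos.2 hpos).ne'
      set s := √(g.inner x v v)
      have := hK (s⁻¹ • v) (by simp [hv]) (by
        simp only [map_smul, smul_apply, smul_eq_mul, ← hs]
        field_simp)
      simp only [map_smul, smul_apply, smul_eq_mul] at this
      field_simp at this
      rw [← hs, this]
      ring
    have h1 : ∀ v : TangentSpace I x,
        g.inner x (leviCivita g ξ x v) (leviCivita g ξ x v)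
          = g.inner x v v - η x v * η x v := by
      intro v
      have := h0 (v - η x v • ξ x) (by simp [h.eta_xi])
      simp only [map_sub, map_smul, h.leviCivita_xi, sub_apply, smul_apply, smul_zero, sub_zero,
        h.inner_xi, h.inner_xi_right, h.eta_xi, smul_eq_mul] at this
      linarith
    intro v
    refine metric_injective (g := g) x ?_
    ext w
    -- Polarization gives g(Pv, Pw) = g(v, w) - η(v)η(w), and skewness turns the left side into
    -- -g(P²v, w).
    have a := h1 (v + w)
    simp only [map_add, add_apply, h1] at a
    have b := h.killing x (leviCivita g ξ x v) w
    rw [g.symm x w v, g.symm x (leviCivita g ξ x w)] at a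
    simp only [map_add, map_neg, map_smul, add_apply, neg_apply, smul_apply, h.inner_xi,
      smul_eq_mul]
    linarith
  · intro hA u hu h1
    have := h.killing x (leviCivita g ξ x u) u
    rw [hA, hu] at this
    simp only [zero_smul, add_zero, map_neg, neg_apply, h1] at this
    linarith

theorem isAlmostContactMetric_operatorA (h : IsAntiQuasiSasakian g φ ξ η)
    (hA : ∀ (x : M) (v : TangentSpace I x),
      operatorA g φ ξ x (operatorA g φ ξ x v) = -v + η x v • ξ x) :
    IsAlmostContactMetric g (operatorA g φ ξ) ξ η where
  smooth_phi x := contMDiffAt_endo_of_apply fun W hW ↦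
    ContMDiffAt.neg_section (h.smoothAt_phi (h.smoothAt_leviCivita_xi hW))
  smooth_xi := h.smooth_xi
  smooth_eta := h.smooth_eta
  phi_sq := hA
  eta_xi := h.eta_xi
  compatible x v w := by
    have := h.killing x v (leviCivita g ξ x w)
    rw [← h.operatorA_sq, hA] at this
    simp only [operatorA_apply, map_neg, neg_apply, h.compatible, h.eta_leviCivita, this, map_add,
      map_smul, h.inner_xi_right, smul_eq_mul]
    ring

theorem isAlmostContactMetric_operatorPsi (h : IsAntiQuasiSasakian g φ ξ η)
    (hA : ∀ (x : M) (v : TangentSpace I x),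
      operatorA g φ ξ x (operatorA g φ ξ x v) = -v + η x v • ξ x) :
    IsAlmostContactMetric g (operatorPsi g φ ξ) ξ η where
  smooth_phi x := contMDiffAt_endo_of_apply fun W hW ↦
    (SmoothAt.congr (ContMDiffAt.neg_section (h.smoothAt_leviCivita_xi hW))
      (.of_forall fun y ↦ h.operatorPsi_apply y (W y)))
  smooth_xi := h.smooth_xi
  smooth_eta := h.smooth_eta
  phi_sq x v := by rw [h.operatorPsi_sq, ← h.operatorA_sq, hA]
  eta_xi := h.eta_xi
  compatible x v w := by
    have := h.killing x v (leviCivita g ξ x w)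
    rw [← h.operatorA_sq, hA] at this
    simp only [h.operatorPsi_apply, map_neg, neg_apply, this, map_add,
      map_smul, h.inner_xi_right, smul_eq_mul]
    ring

/-- With A = -φP and ψ = -P, the quaternionic relations reduce to Pφ = -φP and P² = φ² = -I + η ⊗ ξ.
-/
theorem isDoubleAqSSasakian (h : IsAntiQuasiSasakian g φ ξ η)
    (hA : ∀ (x : M) (v : TangentSpace I x),
      operatorA g φ ξ x (operatorA g φ ξ x v) = -v + η x v • ξ x) :
    IsDoubleAqSSasakian g (operatorA g φ ξ) φ (operatorPsi g φ ξ) ξ η := by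
  have hP : ∀ (x : M) (v : TangentSpace I x),
      leviCivita g ξ x (leviCivita g ξ x v) = -v + η x v • ξ x := by
    intro x v
    rw [← h.operatorA_sq, hA]
  exact
  { acm₁ := h.isAlmostContactMetric_operatorA hA
    acm₂ := h.toIsAlmostContactMetric
    acm₃ := h.isAlmostContactMetric_operatorPsi hA
    quat₁₂ := fun _ _ ↦ rfl
    quat₂₁ := fun x v ↦ by
      rw [operatorA_apply, h.operatorPsi_apply, map_neg, h.phi_sq, h.eta_leviCivita]
      simp
    quat₂₃ := fun x v ↦ by rw [operatorA_apply, h.operatorPsi_apply, map_neg]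
    quat₃₂ := fun x v ↦ by
      rw [operatorA_apply, h.operatorPsi_apply, h.leviCivita_phi]
    quat₃₁ := fun x v ↦ by
      rw [operatorA_apply, h.operatorPsi_apply, map_neg, h.leviCivita_phi, hP]
      simp [h.phi_xi]
    quat₁₃ := fun x v ↦ by
      rw [operatorA_apply, h.operatorPsi_apply, map_neg, hP]
      simp [h.phi_xi]
    closed₁ := h.closed_operatorA
    closed₂ := h.closed
    deta := fun x X Y hX hY ↦ by
      rw [h.extDerivOne_eq_two_mul hX.mdifferentiableAt hY.mdifferentiableAt, fundamentalForm,
        h.operatorPsi_apply, h.killing, map_neg] }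

end IsAntiQuasiSasakian
end AlmostContact

/-! ### The equivalence. -/

theorem mainTheorem2 {n : ℕ} {M : Type*} [TopologicalSpace M]
    [ChartedSpace (EuclideanSpace ℝ (Fin (2 * n + 1))) M] [IsManifold (𝓡 (2 * n + 1)) ∞ M]
    (g : ContMDiffRiemannianMetric (𝓡 (2 * n + 1)) ∞ (EuclideanSpace ℝ (Fin (2 * n + 1)))
      (fun x : M ↦ TangentSpace (𝓡 (2 * n + 1)) x))
    (φ : Π x : M, TangentSpace (𝓡 (2 * n + 1)) x →L[ℝ] TangentSpace (𝓡 (2 * n + 1)) x)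
    (ξ : Π x : M, TangentSpace (𝓡 (2 * n + 1)) x)
    (η : Π x : M, TangentSpace (𝓡 (2 * n + 1)) x →L[ℝ] ℝ)
    (h : IsAntiQuasiSasakian g φ ξ η) :
    List.TFAE [
      ∀ (x : M) (u : TangentSpace (𝓡 (2 * n + 1)) x), η x u = 0 → g.inner x u u = 1 →
        sectionalCurvature g x (ξ x) u = 1,
      (∀ (x : M) (v : TangentSpace (𝓡 (2 * n + 1)) x),
          operatorPsi g φ ξ x (operatorPsi g φ ξ x v)
            = operatorA g φ ξ x (operatorA g φ ξ x v)) ∧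
        (∀ (x : M) (v : TangentSpace (𝓡 (2 * n + 1)) x),
          operatorA g φ ξ x (operatorA g φ ξ x v) = -v + η x v • ξ x),
      IsDoubleAqSSasakian g (operatorA g φ ξ) φ (operatorPsi g φ ξ) ξ η] := by
  tfae_have 1 ↔ 2 := by
    constructor
    · intro hK
      have hA := fun x ↦ (h.sectionalCurvature_xi_eq_one_iff x).1 (hK x)
      -- ψ² = A² holds on every aqS manifold, both being P².
      exact ⟨fun x v ↦ by rw [h.operatorPsi_sq, h.operatorA_sq], hA⟩
    · exact fun hA x ↦ (h.sectionalCurvature_xi_eq_one_iff x).2 (hA.2 x)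
  tfae_have 2 → 3 := fun hA ↦ h.isDoubleAqSSasakian hA.2
  tfae_have 3 → 2 := fun hD ↦
    ⟨fun x v ↦ by rw [hD.acm₃.phi_sq, hD.acm₁.phi_sq], hD.acm₁.phi_sq⟩
  tfae_finish
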